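/- Let $\mathcal{H}$ be a finite-dimensional real Hilbert space and let $f,g\colon\mathcal{H}\to\left]-\infty,+\infty\right]$ be proper lower semicontinuous convex functions. Write $\operatorname{dom} f=\{x\in\mathcal{H}\mid f(x)<+\infty\}$, let $f^*(u)=\sup_{x\in\mathcal{H}}\left(\langle x,u\rangle-f(x)\right)$ be the Fenchel conjugate, let $\operatorname{prox}_f(x)=\operatorname{argmin}_{y\in\mathcal{H}}\left(f(y)+\tfrac12\|y-x\|^2\right)$ be the proximity operator, and let $P_C(x)=\operatorname{argmin}_{y\in C}\|y-x\|$ be the projection onto a nonempty closed convex set $C\subseteq\mathcal{H}$. Moreover, let $\operatorname{rec} C=\{x\in\mathcal{H}\mid x+y\in C\text{ for all }y\in C\}$ be the recession cone of $C$ and $C^\circ=\{u\in\mathcal{H}\mid \sup_{x\in C}\langle x,u\rangle\le 0\}$ the polar cone of $C$. Let $$T=\tfrac12\operatorname{Id}+\tfrac12\left(2\operatorname{prox}_g-\operatorname{Id}\right)\left(2\operatorname{prox}_f-\operatorname{Id}\right)$$ be the Douglas–Rachford operator, let $v=P_{\overline{\operatorname{ran}}(\operatorname{Id}-T)}(0)$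 be its minimal displacement vector, where $\overline{\operatorname{ran}}$ denotes the closure of the range, and set $$v_p=P_{\overline{\operatorname{dom} f-\operatorname{dom} g}}(0),\qquad v_d=P_{\overline{\operatorname{dom} f^*+\operatorname{dom} g^*}}(0).$$ Then $v$ is well defined, that is, $\overline{\operatorname{ran}}(\operatorname{Id}-T)$ has a unique element of minimum norm; $v=v_p+v_d$ and $\langle v_p,v_d\rangle=0$; and $$-v_p=P_{\left(\operatorname{rec}\overline{\operatorname{dom} f}\right)^\circ}(-v),\qquad -v_d=P_{\operatorname{rec}\overline{\operatorname{dom} f}}(-v).$$ Thus $-v=(-v_p)+(-v_d)$ is Moreau's conic decomposition of $-v$ with respect to the recession cone of $\overline{\operatorname{dom} f}$. -/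

import Mathlib

open scoped Pointwise

noncomputable section

namespace DR

variable {H : Type*} [NormedAddCommGroup H] [InnerProductSpace ℝ H]

/-- Proper lower semicontinuous convex functions `f : H → ]-∞, +∞]`. The value `-∞` of `EReal`
is excluded; convexity means that the epigraph of `f` is a convex subset of `H × ℝ`. -/
structure IsProperLscConvex (f : H → EReal) : Prop where
  ne_bot : ∀ x, f x ≠ ⊥
  exists_ne_top : ∃ x, f x ≠ ⊤
  lsc : LowerSemicontinuous f
  convex_epigraph : Convex ℝ {p : H × ℝ | f p.1 ≤ (p.2 : EReal)}

/-- The effective domain of `f`. -/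
def dom (f : H → EReal) : Set H := {x | f x < ⊤}

/-- The Fenchel conjugate of `f`. -/
def conj (f : H → EReal) : H → EReal := fun u => ⨆ x : H, (((inner ℝ x u : ℝ) : EReal) - f x)

/-- `p` is the unique minimizer of `φ` over `C`. -/
def IsArgmin {β : Type*} [LT β] (φ : H → β) (C : Set H) (p : H) : Prop :=
  p ∈ C ∧ ∀ y ∈ C, y ≠ p → φ p < φ y

open Classical in
/-- The unique minimizer of `φ` over `C` (and `0` if there is none). -/
def argmin {β : Type*} [LT β] (φ : H → β) (C : Set H) : H :=
  if h : ∃ p, IsArgmin φ C p then h.choose else 0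

/-- The proximity operator of `f`. -/
def prox (f : H → EReal) (x : H) : H :=
  argmin (fun y => f y + (((1 / 2 : ℝ) * ‖y - x‖ ^ 2 : ℝ) : EReal)) Set.univ

/-- The projection operator onto `C`. -/
def proj (C : Set H) (x : H) : H := argmin (fun y => ‖y - x‖) C

/-- The polar cone of `C`. -/
def polarCone (C : Set H) : Set H := {u | ∀ x ∈ C, inner ℝ x u ≤ 0}

/-- The recession cone of `C`. -/
def recCone (C : Set H) : Set H := {x | ∀ y ∈ C, x + y ∈ C}

/-- The reflected proximity operator `2 prox_f - Id`. -/
def reflProx (f : H → EReal) (x : H) : H := (2 : ℝ) • prox f x - x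

/-- The Douglas-Rachford operator `T = (1/2) Id + (1/2) (2 prox_g - Id) (2 prox_f - Id)`. -/
def drOp (f g : H → EReal) (s : H) : H :=
  (1 / 2 : ℝ) • s + (1 / 2 : ℝ) • reflProx g (reflProx f s)

/-- The range of `Id - T` for the Douglas-Rachford operator `T`. -/
def displacements (f g : H → EReal) : Set H := Set.range fun s => s - drOp f g s

/-- The minimal displacement vector `v` of the Douglas-Rachford operator. -/
def minDispl (f g : H → EReal) : H := proj (closure (displacements f g)) 0

/-- The vector `v_p`. -/
def primalVec (f g : H → EReal) : H := proj (closure (dom f - dom g)) 0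

/-- The vector `v_d`. -/
def dualVec (f g : H → EReal) : H := proj (closure (dom (conj f) + dom (conj g))) 0

/-! Well-definedness of `argmin`, `proj` and `prox`. -/

set_option linter.unusedSectionVars false in
theorem IsArgmin.argmin_eq {β : Type*} [Preorder β] {φ : H → β} {C : Set H} {p : H}
    (h : IsArgmin φ C p) : argmin φ C = p := by
  have hex : ∃ p, IsArgmin φ C p := ⟨p, h⟩
  have hs : IsArgmin φ C (argmin φ C) := by
    unfold argmin
    rw [dif_pos hex]
    exact hex.choose_spec
  by_contra hne
  exact lt_asymm (h.2 _ hs.1 hne) (hs.2 _ h.1 (Ne.symm hne))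

theorem isArgmin_proj [FiniteDimensional ℝ H] {C : Set H} (hne : C.Nonempty) (hcl : IsClosed C)
    (hcv : Convex ℝ C) (x : H) : IsArgmin (fun y => ‖y - x‖) C (proj C x) := by
  have : CompleteSpace H := FiniteDimensional.complete ℝ H
  obtain ⟨p, hp, hmin⟩ := exists_norm_eq_iInf_of_complete_convex hne hcl.isComplete hcv x
  have hvi := (norm_eq_iInf_iff_real_inner_le_zero hcv hp).1 hmin
  have key : IsArgmin (fun y => ‖y - x‖) C p := by
    refine ⟨hp, fun y hy hyp => ?_⟩
    have h1 := hvi y hy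
    have h2 : ‖y - x‖ ^ 2 = ‖y - p‖ ^ 2 - 2 * inner ℝ (x - p) (y - p) + ‖p - x‖ ^ 2 := by
      have h := norm_sub_sq_real (y - p) (x - p)
      rw [sub_sub_sub_cancel_right, real_inner_comm, norm_sub_rev x p] at h
      exact h
    have h3 : 0 < ‖y - p‖ := norm_pos_iff.2 (sub_ne_zero.2 hyp)
    exact lt_of_pow_lt_pow_left₀ 2 (norm_nonneg _) (by nlinarith)
  unfold proj
  rw [key.argmin_eq]
  exact key

theorem IsProperLscConvex.exists_affine_le {f : H → EReal} (hf : IsProperLscConvex f) :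
    ∃ (l : H →L[ℝ] ℝ) (c : ℝ), ∀ y, ((l y + c : ℝ) : EReal) ≤ f y := by
  obtain ⟨x₀, hx₀⟩ := hf.exists_ne_top
  obtain ⟨r, hr⟩ : ∃ r : ℝ, f x₀ = r := ⟨_, (EReal.coe_toReal hx₀ (hf.ne_bot x₀)).symm⟩
  have hcl : IsClosed {p : H × ℝ | f p.1 ≤ (p.2 : EReal)} :=
    hf.lsc.isClosed_epigraph.preimage
      (continuous_fst.prodMk (continuous_coe_real_ereal.comp continuous_snd))
  have hnot : (x₀, r - 1) ∉ {p : H × ℝ | f p.1 ≤ (p.2 : EReal)} := by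
    simp only [Set.mem_ofPred_eq, hr, not_le, EReal.coe_lt_coe_iff]
    linarith
  obtain ⟨φ, u, h1, h2⟩ := geometric_hahn_banach_point_closed hf.convex_epigraph hcl hnot
  set L : H →L[ℝ] ℝ := φ.comp (ContinuousLinearMap.inl ℝ H ℝ) with hL
  set b : ℝ := φ (0, 1) with hb
  have hφ : ∀ y t, φ (y, t) = L y + t * b := by
    intro y t
    have : ((y, t) : H × ℝ) = (y, 0) + t • ((0 : H), (1 : ℝ)) := by simp
    rw [this, map_add, map_smul]
    simp [hL, hb]
  have h3 : u < L x₀ + r * b := by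
    rw [← hφ]
    exact h2 (x₀, r) (by simp [hr])
  rw [hφ] at h1
  have hbpos : 0 < b := by linarith
  refine ⟨-(b⁻¹ • L), u / b, fun y => ?_⟩
  by_cases hy : f y = ⊤
  · simp [hy]
  obtain ⟨t, ht⟩ : ∃ t : ℝ, f y = t := ⟨_, (EReal.coe_toReal hy (hf.ne_bot y)).symm⟩
  have h4 : u < L y + t * b := by
    rw [← hφ]
    exact h2 (y, t) (by simp [ht])
  rw [ht, EReal.coe_le_coe_iff]
  have h5 : (-(b⁻¹ • L)) y + u / b = (u - L y) / b := by
    simp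
    field_simp
    ring
  rw [h5, div_le_iff₀ hbpos]
  linarith

theorem isArgmin_prox [FiniteDimensional ℝ H] {f : H → EReal} (hf : IsProperLscConvex f) (x : H) :
    IsArgmin (fun y => f y + (((1 / 2 : ℝ) * ‖y - x‖ ^ 2 : ℝ) : EReal)) Set.univ (prox f x) := by
  have : ProperSpace H := FiniteDimensional.proper ℝ H
  obtain ⟨l, c, hlc⟩ := hf.exists_affine_le
  obtain ⟨x₀, hx₀⟩ := hf.exists_ne_top
  obtain ⟨r, hr⟩ : ∃ r : ℝ, f x₀ = r := ⟨_, (EReal.coe_toReal hx₀ (hf.ne_bot x₀)).symm⟩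
  set q : H → EReal := fun y => f y + (((1 / 2 : ℝ) * ‖y - x‖ ^ 2 : ℝ) : EReal) with hq
  have hlsc : LowerSemicontinuous q := by
    refine hf.lsc.add' (Continuous.lowerSemicontinuous ?_) fun y => ?_
    · exact continuous_coe_real_ereal.comp (by fun_prop)
    · exact EReal.continuousAt_add (Or.inr (EReal.coe_ne_bot _)) (Or.inr (EReal.coe_ne_top _))
  set m : ℝ := r + 1 / 2 * ‖x₀ - x‖ ^ 2 with hm
  set M : ℝ := m - l x - c with hM
  set R : ℝ := max (2 * ‖l‖ + |M| + 2) ‖x₀ - x‖ with hR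
  have hq₀ : q x₀ = (m : ℝ) := by simp only [hq, hr, hm, EReal.coe_add]
  have hx₀R : x₀ ∈ Metric.closedBall x R := by
    rw [Metric.mem_closedBall, dist_eq_norm]
    exact le_max_right _ _
  obtain ⟨p, -, hpmin⟩ := LowerSemicontinuousOn.exists_isMinOn ⟨x₀, hx₀R⟩
    (isCompact_closedBall x R) (hlsc.lowerSemicontinuousOn _)
  rw [isMinOn_iff] at hpmin
  have hpm : q p ≤ (m : ℝ) := hq₀ ▸ hpmin x₀ hx₀R
  have hglob : ∀ y, q p ≤ q y := by
    intro y
    by_cases hy : y ∈ Metric.closedBall x R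
    · exact hpmin y hy
    · refine hpm.trans ?_
      rw [Metric.mem_closedBall, dist_eq_norm, not_le] at hy
      have hd : 2 * ‖l‖ + |M| + 2 < ‖y - x‖ := (le_max_left _ _).trans_lt hy
      have h1 : |l (y - x)| ≤ ‖l‖ * ‖y - x‖ := l.le_opNorm _
      rw [map_sub] at h1
      have h2 := neg_abs_le (l y - l x)
      have h3 := le_abs_self M
      have h4 := abs_nonneg M
      have h5 := norm_nonneg l
      have h6 : m ≤ l y + c + 1 / 2 * ‖y - x‖ ^ 2 := by nlinarith
      calc ((m : ℝ) : EReal) ≤ ((l y + c + 1 / 2 * ‖y - x‖ ^ 2 : ℝ) : EReal) :=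
            EReal.coe_le_coe_iff.2 h6
        _ = ((l y + c : ℝ) : EReal) + ((1 / 2 * ‖y - x‖ ^ 2 : ℝ) : EReal) := EReal.coe_add _ _
        _ ≤ q y := add_le_add_left (hlc y) _
  have key : IsArgmin q Set.univ p := by
    refine ⟨trivial, fun y _ hyp => ?_⟩
    by_contra hlt
    have hle : q y ≤ q p := not_lt.1 hlt
    have fin : ∀ z, q z ≤ (m : ℝ) → ∃ t : ℝ, f z = t := by
      intro z hz
      refine ⟨_, (EReal.coe_toReal (fun htop => ?_) (hf.ne_bot z)).symm⟩
      simp only [hq, htop, EReal.top_add_coe] at hz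
      exact EReal.coe_ne_top _ (top_le_iff.1 hz)
    obtain ⟨a, ha⟩ := fin p hpm
    obtain ⟨b, hb⟩ := fin y (hle.trans hpm)
    have hmid : f ((1 / 2 : ℝ) • p + (1 / 2 : ℝ) • y) ≤ ((1 / 2 * a + 1 / 2 * b : ℝ) : EReal) := by
      have := hf.convex_epigraph (x := (p, a)) (by simp [ha]) (y := (y, b)) (by simp [hb])
        (a := (1 / 2 : ℝ)) (b := (1 / 2 : ℝ)) (by norm_num) (by norm_num) (by norm_num)
      simpa using this
    have h1 := (hglob ((1 / 2 : ℝ) • p + (1 / 2 : ℝ) • y)).trans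
      (add_le_add_left hmid (((1 / 2 : ℝ) * ‖(1 / 2 : ℝ) • p + (1 / 2 : ℝ) • y - x‖ ^ 2 : ℝ) : EReal))
    simp only [hq, ha, hb, ← EReal.coe_add, EReal.coe_le_coe_iff] at h1 hle
    have e1 : (1 / 2 : ℝ) • p + (1 / 2 : ℝ) • y - x = (1 / 2 : ℝ) • ((p - x) + (y - x)) := by
      module
    have e2 := parallelogram_law_with_norm ℝ (p - x) (y - x)
    have e3 : p - x - (y - x) = p - y := by abel
    have e4 : 0 < ‖p - y‖ := norm_pos_iff.2 (sub_ne_zero.2 (Ne.symm hyp))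
    rw [e1, norm_smul, mul_pow] at h1
    rw [e3] at e2
    norm_num at h1
    nlinarith
  unfold prox
  rw [key.argmin_eq]
  exact key

end DR

end

/-!
Write `D_p = dom f - dom g` and `D_d = dom f* + dom g*`. If `x = prox_f s`, `u = s - x`,
`y = prox_g (x - u)` and `w = x - u - y`, then `u ∈ ∂f(x)`, `w ∈ ∂g(y)` and
`s - T s = x - y = u + w`, so every displacement lies in `D_p ∩ D_d`. The proof rests on two facts.

* `mem_closure_displacements`: conversely, a point `z` of `closure D_p ∩ closure D_d` is a limit of
  displacements. As `T` is nonexpansive, Banach's theorem solves `ε s + (s - T s) = z` for every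
  `ε > 0`. Subdifferentials are `3*`-monotone: `⟨x - x₀, u - u₀⟩` is bounded below over the graph
  of `∂f` when `x₀ ∈ dom f` and `u₀ ∈ dom f*`. Applied to points with `x₀ - y₀` and `u₀ + w₀`
  close to `z`, this forces `ε s` to become small.
* `mem_recCone_closure_dom`: a vector `d` for which `⟨d, ·⟩` is bounded above on `dom f*` is a
  recession direction of `closure (dom f)`. Otherwise a functional `a` strictly separates some
  `x + d`, `x ∈ dom f`, from `dom f`; then `⟨d, a⟩ > 0`, while `a`, being bounded above on `dom f`,
  is a recession direction of `dom f*`.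

The variational inequality of the projection `v_d` bounds `⟨-v_d, ·⟩` above on `dom f*` and on
`dom g*`, so `-v_d` is a recession direction of `closure (dom f)` and of `closure (dom g)`. The one
of `v_p` bounds `⟨-v_p, ·⟩` above on `dom f` and `⟨v_p, ·⟩` above on `dom g`, so `-v_p` and `v_p`
are polar to the two recession cones. Hence `⟨v_p, v_d⟩ = 0`, and `-v = -v_p - v_d` is Moreau's
decomposition. Translating by these recession directions shows
`v_p + v_d ∈ closure D_p ∩ closure D_d`, and adding the two variational inequalities gives
`⟨v_p + v_d, d⟩ ≥ ‖v_p + v_d‖²` for every `d` in that intersection, so `v_p + v_d` is its unique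
element of least norm.
-/

open scoped Pointwise

namespace DR

variable {H : Type*} [NormedAddCommGroup H] [InnerProductSpace ℝ H]

/-! ### Domains, conjugates and affine minorants -/

theorem IsProperLscConvex.exists_coe_eq {f : H → EReal} (hf : IsProperLscConvex f) {x : H}
    (hx : x ∈ dom f) : ∃ r : ℝ, f x = r :=
  ⟨_, (EReal.coe_toReal (ne_of_lt hx) (hf.ne_bot x)).symm⟩

theorem IsProperLscConvex.dom_nonempty {f : H → EReal} (hf : IsProperLscConvex f) :
    (dom f).Nonempty :=
  let ⟨x, hx⟩ := hf.exists_ne_top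
  ⟨x, show f x < ⊤ from lt_top_iff_ne_top.2 hx⟩

theorem IsProperLscConvex.map_combo_le {f : H → EReal} (hf : IsProperLscConvex f) {x y : H}
    {r t a b : ℝ} (hx : f x = r) (hy : f y = t) (ha : 0 ≤ a) (hb : 0 ≤ b) (hab : a + b = 1) :
    f (a • x + b • y) ≤ ((a * r + b * t : ℝ) : EReal) := by
  have := hf.convex_epigraph (x := (x, r)) (by simp [hx]) (y := (y, t)) (by simp [hy]) ha hb hab
  simpa using this

theorem IsProperLscConvex.convex_dom {f : H → EReal} (hf : IsProperLscConvex f) :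
    Convex ℝ (dom f) := by
  intro x hx y hy a b ha hb hab
  obtain ⟨r, hr⟩ := hf.exists_coe_eq hx
  obtain ⟨t, ht⟩ := hf.exists_coe_eq hy
  exact (hf.map_combo_le hr ht ha hb hab).trans_lt (EReal.coe_lt_top _)

set_option linter.unusedSectionVars false in
theorem eq_top_of_notMem_dom {f : H → EReal} {x : H} (hx : x ∉ dom f) : f x = ⊤ :=
  not_lt_top_iff.1 hx

/-- The domain of `f*` consists of the slopes of the affine minorants of `f`. -/
theorem mem_dom_conj {f : H → EReal} {u : H} :
    u ∈ dom (conj f) ↔ ∃ M : ℝ, ∀ x, ((inner ℝ x u - M : ℝ) : EReal) ≤ f x := by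
  have key : ∀ (M : ℝ) (x : H), ((inner ℝ x u : ℝ) : EReal) - f x ≤ M ↔
      ((inner ℝ x u - M : ℝ) : EReal) ≤ f x := by
    intro M x
    induction f x using EReal.rec with
    | bot => simp [-EReal.coe_sub]
    | top => simp
    | coe r =>
      rw [← EReal.coe_sub, EReal.coe_le_coe_iff, EReal.coe_le_coe_iff]
      constructor <;> intro h <;> linarith
  constructor
  · intro h
    obtain ⟨M, hM, -⟩ := EReal.lt_iff_exists_real_btwn.1 (show conj f u < ⊤ from h)
    exact ⟨M, fun x => (key M x).1 ((le_iSup (fun x : H =>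
      (((inner ℝ x u : ℝ) : EReal) - f x)) x).trans hM.le)⟩
  · rintro ⟨M, hM⟩
    exact (iSup_le fun x => (key M x).2 (hM x)).trans_lt (EReal.coe_lt_top M)

theorem convex_dom_conj (f : H → EReal) : Convex ℝ (dom (conj f)) := by
  intro u hu w hw a b ha hb hab
  obtain ⟨M, hM⟩ := mem_dom_conj.1 hu
  obtain ⟨N, hN⟩ := mem_dom_conj.1 hw
  refine mem_dom_conj.2 ⟨a * M + b * N, fun x => ?_⟩
  have h : ((max (inner ℝ x u - M) (inner ℝ x w - N) : ℝ) : EReal) ≤ f x := by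
    rcases max_choice (inner ℝ x u - M) (inner ℝ x w - N) with h | h <;> rw [h]
    exacts [hM x, hN x]
  refine (EReal.coe_le_coe_iff.2 ?_).trans h
  rw [inner_add_right, inner_smul_right, inner_smul_right]
  have h1 := Convex.min_le_combo (-(inner ℝ x u - M)) (-(inner ℝ x w - N)) ha hb hab
  rw [min_neg_neg, smul_eq_mul, smul_eq_mul] at h1
  linarith

/-- A vector bounded above on `dom f` is a recession direction of `dom f*`. -/
theorem add_mem_dom_conj {f : H → EReal} {a u : H} {β : ℝ}
    (ha : ∀ x ∈ dom f, inner ℝ x a ≤ β) (hu : u ∈ dom (conj f)) :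
    u + a ∈ dom (conj f) := by
  obtain ⟨M, hM⟩ := mem_dom_conj.1 hu
  refine mem_dom_conj.2 ⟨M + β, fun x => ?_⟩
  by_cases hx : x ∈ dom f
  · refine le_trans (EReal.coe_le_coe_iff.2 ?_) (hM x)
    have := ha x hx
    rw [inner_add_right]
    linarith
  · rw [eq_top_of_notMem_dom hx]
    exact le_top

/-! ### Displacements -/

theorem sub_drOp (f g : H → EReal) (s : H) :
    s - drOp f g s = prox f s - prox g (reflProx f s) := by
  simp only [drOp, reflProx]
  module

theorem sub_drOp' (f g : H → EReal) (s : H) :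
    s - drOp f g s = (s - prox f s) + (reflProx f s - prox g (reflProx f s)) := by
  simp only [drOp, reflProx]
  module

/-- The estimate behind `mem_closure_displacements`. The vectors `p` and `q` are the errors with
which `z` is approximated from `dom f - dom g` and from `dom f* + dom g*`. -/
theorem mul_norm_sq_le_of_le_inner {x u y w x₀ u₀ y₀ w₀ z p q : H} {ε C δ c : ℝ} (hε : 0 < ε)
    (hC : -C ≤ inner ℝ (x - x₀) (u - u₀) + inner ℝ (y - y₀) (w - w₀))
    (hxy : x - y = z - ε • (x + u)) (huw : u + w = z - ε • (x + u))
    (hxy₀ : x₀ - y₀ = z + p) (huw₀ : u₀ + w₀ = z + q) (hp : ‖p‖ ≤ δ) (hq : ‖q‖ ≤ δ)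
    (hx : ‖x‖ ≤ ‖x + u‖ + c) (hu : ‖u‖ ≤ ‖x + u‖ + c) :
    ε * ‖x + u‖ ^ 2 ≤ (C + δ * (2 * c + ‖x₀‖ + ‖u₀‖) + δ ^ 2)
      + (‖x₀ + u₀‖ + 2 * δ) * (ε * ‖x + u‖) + 2 * δ * ‖x + u‖ := by
  have hδ : 0 ≤ δ := (norm_nonneg _).trans hp
  set s := x + u with hs
  have ey : y - y₀ = (x - x₀) + (ε • s + p) := by
    rw [eq_sub_of_add_eq' (sub_eq_iff_eq_add.1 hxy).symm, eq_sub_of_add_eq'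
      (sub_eq_iff_eq_add.1 hxy₀).symm]
    abel
  have ew : w - w₀ = -(ε • s + q) - (u - u₀) := by
    rw [eq_sub_of_add_eq' huw, eq_sub_of_add_eq' huw₀]
    abel
  have key : inner ℝ (x - x₀) (u - u₀) + inner ℝ (y - y₀) (w - w₀)
      = -(ε * ‖s‖ ^ 2) + ε * inner ℝ (x₀ + u₀) s - inner ℝ (x - x₀) q - inner ℝ (u - u₀) p
        - ε ^ 2 * ‖s‖ ^ 2 - ε * inner ℝ s p - ε * inner ℝ s q - inner ℝ p q := by
    have e : ‖s‖ ^ 2 = inner ℝ (x - x₀) s + inner ℝ (u - u₀) s + inner ℝ (x₀ + u₀) s := by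
      rw [← inner_add_left, ← inner_add_left, ← real_inner_self_eq_norm_sq]
      congr 1
      rw [hs]
      abel
    have e' : inner ℝ s s = ‖s‖ ^ 2 := real_inner_self_eq_norm_sq s
    rw [ey, ew]
    simp only [inner_sub_right, inner_add_left, inner_add_right, inner_neg_right,
      inner_smul_left, inner_smul_right, conj_trivial, e', inner_sub_left] at e ⊢
    rw [real_inner_comm u s, real_inner_comm u₀ s, real_inner_comm u p, real_inner_comm u₀ p,
      real_inner_comm s p]
    linear_combination ε * e
  have b1 : inner ℝ (x₀ + u₀) s ≤ ‖x₀ + u₀‖ * ‖s‖ := real_inner_le_norm _ _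
  have b2 : -(‖x - x₀‖ * ‖q‖) ≤ inner ℝ (x - x₀) q :=
    (abs_le.1 (abs_real_inner_le_norm _ _)).1
  have b3 : -(‖u - u₀‖ * ‖p‖) ≤ inner ℝ (u - u₀) p :=
    (abs_le.1 (abs_real_inner_le_norm _ _)).1
  have b4 : -(‖s‖ * ‖p‖) ≤ inner ℝ s p := (abs_le.1 (abs_real_inner_le_norm _ _)).1
  have b5 : -(‖s‖ * ‖q‖) ≤ inner ℝ s q := (abs_le.1 (abs_real_inner_le_norm _ _)).1
  have b6 : -(‖p‖ * ‖q‖) ≤ inner ℝ p q := (abs_le.1 (abs_real_inner_le_norm _ _)).1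
  have c2 : ‖x - x₀‖ * ‖q‖ ≤ (‖s‖ + c + ‖x₀‖) * δ :=
    mul_le_mul ((norm_sub_le _ _).trans (by linarith)) hq (norm_nonneg _)
      (by linarith [norm_nonneg x, norm_nonneg x₀])
  have c3 : ‖u - u₀‖ * ‖p‖ ≤ (‖s‖ + c + ‖u₀‖) * δ :=
    mul_le_mul ((norm_sub_le _ _).trans (by linarith)) hp (norm_nonneg _)
      (by linarith [norm_nonneg u, norm_nonneg u₀])
  have c4 : ‖s‖ * ‖p‖ ≤ ‖s‖ * δ := mul_le_mul_of_nonneg_left hp (norm_nonneg _)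
  have c5 : ‖s‖ * ‖q‖ ≤ ‖s‖ * δ := mul_le_mul_of_nonneg_left hq (norm_nonneg _)
  have c6 : ‖p‖ * ‖q‖ ≤ δ * δ := mul_le_mul hp hq (norm_nonneg _) hδ
  have d1 := mul_le_mul_of_nonneg_left b1 hε.le
  have d4 := mul_le_mul_of_nonneg_left (b4.trans' (neg_le_neg c4)) hε.le
  have d5 := mul_le_mul_of_nonneg_left (b5.trans' (neg_le_neg c5)) hε.le
  have d7 : 0 ≤ ε ^ 2 * ‖s‖ ^ 2 := by positivity
  rw [key] at hC
  linarith

/-! ### Subgradients and proximity operators -/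

section Prox

variable [FiniteDimensional ℝ H]

/-- The residual `s - prox_f s` is a subgradient of `f` at `prox_f s`. -/
theorem IsProperLscConvex.prox_subgradient {f : H → EReal} (hf : IsProperLscConvex f) (s : H) :
    ∃ r : ℝ, f (prox f s) = r ∧
      ∀ y, ((r + inner ℝ (s - prox f s) (y - prox f s) : ℝ) : EReal) ≤ f y := by
  have hmin := isArgmin_prox hf s
  set x := prox f s with hx
  have hle : ∀ y, f x + (((1 / 2 : ℝ) * ‖x - s‖ ^ 2 : ℝ) : EReal)
      ≤ f y + (((1 / 2 : ℝ) * ‖y - s‖ ^ 2 : ℝ) : EReal) := by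
    intro y
    by_cases hy : y = x
    · rw [hy]
    · exact (hmin.2 y trivial hy).le
  have hxd : x ∈ dom f := by
    obtain ⟨x₀, hx₀⟩ := hf.dom_nonempty
    obtain ⟨r, hr⟩ := hf.exists_coe_eq hx₀
    have h := hle x₀
    rw [hr, ← EReal.coe_add] at h
    by_contra hnot
    rw [eq_top_of_notMem_dom hnot, EReal.top_add_coe] at h
    exact EReal.coe_ne_top _ (top_le_iff.1 h)
  obtain ⟨r, hr⟩ := hf.exists_coe_eq hxd
  refine ⟨r, hr, fun y => ?_⟩
  by_cases hy : y ∈ dom f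
  swap
  · rw [eq_top_of_notMem_dom hy]
    exact le_top
  obtain ⟨b, hb⟩ := hf.exists_coe_eq hy
  rw [hb, EReal.coe_le_coe_iff]
  by_contra hlt
  have hlt := not_le.1 hlt
  set c := r + inner ℝ (s - x) (y - x) - b with hc
  have hc0 : 0 < c := by linarith
  -- a point of the segment from `x` to `y` so close to `x` that the quadratic term is negligible
  set t := min 1 (c / (‖y - x‖ ^ 2 + 1)) with ht
  have hN : 0 < ‖y - x‖ ^ 2 + 1 := by positivity
  have ht0 : 0 < t := lt_min one_pos (div_pos hc0 hN)
  have ht1 : t ≤ 1 := min_le_left _ _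
  have htc : t * (‖y - x‖ ^ 2 + 1) ≤ c := (le_div_iff₀ hN).1 (min_le_right _ _)
  have h1 := (hle ((1 - t) • x + t • y)).trans
    (add_le_add_left (hf.map_combo_le hr hb (sub_nonneg.2 ht1) ht0.le (by ring)) _)
  rw [hr, ← EReal.coe_add, ← EReal.coe_add, EReal.coe_le_coe_iff] at h1
  have e1 : (1 - t) • x + t • y - s = t • (y - x) - (s - x) := by module
  rw [e1, norm_sub_sq_real (t • (y - x)), norm_smul, inner_smul_left, norm_sub_rev x s, mul_pow,
    Real.norm_eq_abs, sq_abs, real_inner_comm] at h1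
  simp only [conj_trivial] at h1
  have h2 : 0 ≤ t * (-c + 1 / 2 * (t * ‖y - x‖ ^ 2)) := by
    rw [hc]
    linarith
  have h3 := nonneg_of_mul_nonneg_right h2 ht0
  linarith

theorem IsProperLscConvex.prox_mem_dom {f : H → EReal} (hf : IsProperLscConvex f) (s : H) :
    prox f s ∈ dom f := by
  obtain ⟨r, hr, -⟩ := hf.prox_subgradient s
  exact hr.trans_lt (EReal.coe_lt_top r)

theorem IsProperLscConvex.sub_prox_mem_dom_conj {f : H → EReal} (hf : IsProperLscConvex f)
    (s : H) : s - prox f s ∈ dom (conj f) := by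
  obtain ⟨r, -, h⟩ := hf.prox_subgradient s
  refine mem_dom_conj.2 ⟨inner ℝ (prox f s) (s - prox f s) - r, fun y => ?_⟩
  refine (EReal.coe_le_coe_iff.2 (le_of_eq ?_)).trans (h y)
  rw [inner_sub_right (s - prox f s), real_inner_comm (s - prox f s) y,
    real_inner_comm (s - prox f s) (prox f s)]
  ring

theorem IsProperLscConvex.dom_conj_nonempty {f : H → EReal} (hf : IsProperLscConvex f) :
    (dom (conj f)).Nonempty :=
  ⟨_, hf.sub_prox_mem_dom_conj 0⟩

theorem IsProperLscConvex.prox_monotone {f : H → EReal} (hf : IsProperLscConvex f) (s s' : H) :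
    0 ≤ inner ℝ (prox f s - prox f s') ((s - prox f s) - (s' - prox f s')) := by
  obtain ⟨r, hr, h⟩ := hf.prox_subgradient s
  obtain ⟨r', hr', h'⟩ := hf.prox_subgradient s'
  have h1 := h (prox f s')
  have h2 := h' (prox f s)
  rw [hr', EReal.coe_le_coe_iff] at h1
  rw [hr, EReal.coe_le_coe_iff, ← neg_sub (prox f s') (prox f s), inner_neg_right] at h2
  rw [← neg_sub (prox f s') (prox f s), inner_neg_left, inner_sub_right,
    real_inner_comm (s - prox f s), real_inner_comm (s' - prox f s')]
  linarith

/-- Firm nonexpansiveness of the proximity operator. -/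
theorem IsProperLscConvex.prox_firmly_nonexpansive {f : H → EReal} (hf : IsProperLscConvex f)
    (s s' : H) :
    ‖prox f s - prox f s'‖ ^ 2 + ‖(s - prox f s) - (s' - prox f s')‖ ^ 2 ≤ ‖s - s'‖ ^ 2 := by
  have h := hf.prox_monotone s s'
  have e : s - s' = (prox f s - prox f s') + ((s - prox f s) - (s' - prox f s')) := by abel
  rw [e, norm_add_sq_real]
  linarith

theorem IsProperLscConvex.norm_prox_le {f : H → EReal} (hf : IsProperLscConvex f) (s : H) :
    ‖prox f s‖ ≤ ‖s‖ + ‖prox f 0‖ := by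
  have h := hf.prox_firmly_nonexpansive s 0
  rw [sub_zero] at h
  have h1 : ‖prox f s - prox f 0‖ ≤ ‖s‖ :=
    le_of_sq_le_sq (by nlinarith [sq_nonneg ‖s - prox f s - (0 - prox f 0)‖]) (norm_nonneg _)
  have h2 := norm_sub_norm_le (prox f s) (prox f 0)
  linarith

theorem IsProperLscConvex.norm_sub_prox_le {f : H → EReal} (hf : IsProperLscConvex f) (s : H) :
    ‖s - prox f s‖ ≤ ‖s‖ + ‖prox f 0‖ := by
  have h := hf.prox_firmly_nonexpansive s 0
  rw [sub_zero] at h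
  have h1 : ‖s - prox f s - (0 - prox f 0)‖ ≤ ‖s‖ :=
    le_of_sq_le_sq (by nlinarith [sq_nonneg ‖prox f s - prox f 0‖]) (norm_nonneg _)
  have h2 := norm_sub_norm_le (s - prox f s) (0 - prox f 0)
  rw [zero_sub, norm_neg] at h2
  rw [zero_sub] at h1
  linarith

/-- The `3*`-monotonicity of the subdifferential: over the graph points
`(prox_f s, s - prox_f s)`, the inner product with a fixed point of `dom f × dom f*` is bounded
below. -/
theorem IsProperLscConvex.exists_le_inner_prox {f : H → EReal} (hf : IsProperLscConvex f)
    {x₀ u₀ : H} (hx₀ : x₀ ∈ dom f) (hu₀ : u₀ ∈ dom (conj f)) :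
    ∃ C : ℝ, ∀ s, -C ≤ inner ℝ (prox f s - x₀) ((s - prox f s) - u₀) := by
  obtain ⟨r₀, hr₀⟩ := hf.exists_coe_eq hx₀
  obtain ⟨M, hM⟩ := mem_dom_conj.1 hu₀
  refine ⟨r₀ + M - inner ℝ x₀ u₀, fun s => ?_⟩
  obtain ⟨r, hr, h⟩ := hf.prox_subgradient s
  have h1 := h x₀
  have h2 := hM (prox f s)
  rw [hr₀, EReal.coe_le_coe_iff, real_inner_comm, ← neg_sub (prox f s), inner_neg_left] at h1
  rw [hr, EReal.coe_le_coe_iff] at h2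
  rw [inner_sub_right, inner_sub_left _ _ u₀]
  linarith

/-! ### The range of the displacement mapping -/

theorem displacements_subset_primal {f g : H → EReal} (hf : IsProperLscConvex f)
    (hg : IsProperLscConvex g) : displacements f g ⊆ dom f - dom g := by
  rintro _ ⟨s, rfl⟩
  exact Set.mem_sub.2 ⟨_, hf.prox_mem_dom s, _, hg.prox_mem_dom _, (sub_drOp f g s).symm⟩

theorem displacements_subset_dual {f g : H → EReal} (hf : IsProperLscConvex f)
    (hg : IsProperLscConvex g) : displacements f g ⊆ dom (conj f) + dom (conj g) := by
  rintro _ ⟨s, rfl⟩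
  exact Set.mem_add.2 ⟨_, hf.sub_prox_mem_dom_conj s, _, hg.sub_prox_mem_dom_conj _,
    (sub_drOp' f g s).symm⟩

theorem IsProperLscConvex.norm_reflProx_sub_le {f : H → EReal} (hf : IsProperLscConvex f)
    (s s' : H) : ‖reflProx f s - reflProx f s'‖ ≤ ‖s - s'‖ := by
  have h := hf.prox_monotone s s'
  have e : s - s' = (prox f s - prox f s') + ((s - prox f s) - (s' - prox f s')) := by abel
  have e' : reflProx f s - reflProx f s'
      = (prox f s - prox f s') - ((s - prox f s) - (s' - prox f s')) := by
    simp only [reflProx]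
    module
  refine le_of_sq_le_sq ?_ (norm_nonneg _)
  rw [e, e', norm_add_sq_real, norm_sub_sq_real]
  linarith

theorem norm_drOp_sub_le {f g : H → EReal} (hf : IsProperLscConvex f) (hg : IsProperLscConvex g)
    (s s' : H) : ‖drOp f g s - drOp f g s'‖ ≤ ‖s - s'‖ := by
  have h := (hg.norm_reflProx_sub_le (reflProx f s) (reflProx f s')).trans
    (hf.norm_reflProx_sub_le s s')
  have e : drOp f g s - drOp f g s' = (1 / 2 : ℝ) • ((s - s')
      + (reflProx g (reflProx f s) - reflProx g (reflProx f s'))) := by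
    simp only [drOp]
    module
  rw [e, norm_smul, Real.norm_of_nonneg (by norm_num)]
  have := norm_add_le (s - s') (reflProx g (reflProx f s) - reflProx g (reflProx f s'))
  linarith

theorem exists_smul_add_sub_drOp_eq {f g : H → EReal} (hf : IsProperLscConvex f)
    (hg : IsProperLscConvex g) (z : H) {ε : ℝ} (hε : 0 < ε) :
    ∃ s, ε • s + (s - drOp f g s) = z := by
  have : CompleteSpace H := FiniteDimensional.complete ℝ H
  have hK : 0 ≤ (1 + ε)⁻¹ := by positivity
  have hc : ContractingWith (1 + ε)⁻¹.toNNReal fun s => (1 + ε)⁻¹ • (drOp f g s + z) := by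
    refine ⟨?_, LipschitzWith.of_dist_le_mul fun s s' => ?_⟩
    · rw [Real.toNNReal_lt_one]
      exact inv_lt_one_of_one_lt₀ (by linarith)
    · rw [dist_eq_norm, dist_eq_norm, ← smul_sub, add_sub_add_right_eq_sub, norm_smul,
        Real.norm_of_nonneg hK, Real.coe_toNNReal _ hK]
      exact mul_le_mul_of_nonneg_left (norm_drOp_sub_le hf hg s s') hK
  refine ⟨hc.fixedPoint, ?_⟩
  set s := hc.fixedPoint with hs
  have h : (1 + ε)⁻¹ • (drOp f g s + z) = s := hc.fixedPoint_isFixedPt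
  have h' : drOp f g s + z = (1 + ε) • s := by
    rw [← h, smul_inv_smul₀ (by positivity), h]
  rw [eq_sub_of_add_eq' h']
  module

/-- Every common limit point of `dom f - dom g` and `dom f* + dom g*` is a limit of
displacements. -/
theorem mem_closure_displacements {f g : H → EReal} (hf : IsProperLscConvex f)
    (hg : IsProperLscConvex g) {z : H} (hz : z ∈ closure (dom f - dom g))
    (hz' : z ∈ closure (dom (conj f) + dom (conj g))) : z ∈ closure (displacements f g) := by
  rw [Metric.mem_closure_iff] at hz hz' ⊢
  intro η hη
  set δ := η / 4 with hδ
  have hδ0 : 0 < δ := by positivity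
  obtain ⟨_, ⟨x₀, hx₀, y₀, hy₀, rfl⟩, hp⟩ := hz δ hδ0
  obtain ⟨_, ⟨u₀, hu₀, w₀, hw₀, rfl⟩, hq⟩ := hz' δ hδ0
  rw [dist_comm, dist_eq_norm] at hp hq
  obtain ⟨C₁, hC₁⟩ := hf.exists_le_inner_prox hx₀ hu₀
  obtain ⟨C₂, hC₂⟩ := hg.exists_le_inner_prox hy₀ hw₀
  set K := C₁ + C₂ + δ * (2 * ‖prox f 0‖ + ‖x₀‖ + ‖u₀‖) + δ ^ 2 with hK
  set L := ‖x₀ + u₀‖ + 2 * δ with hL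
  have hL0 : 0 ≤ L := by positivity
  -- with `a = ε ‖s‖`, the estimate reads `a ‖s‖ ≤ K + L a + 2 δ ‖s‖`; if `a > 3 δ`, it bounds `‖s‖`
  -- by `|K| / δ + 3 L`, which is impossible once `ε` is small
  set B := |K| / δ + 3 * L + 1 with hB
  have hB0 : 0 < B := by positivity
  set ε := 3 * δ / B with hεdef
  have hε : 0 < ε := by positivity
  obtain ⟨s, hs⟩ := exists_smul_add_sub_drOp_eq hf hg z hε
  refine ⟨_, ⟨s, rfl⟩, ?_⟩
  have hsz : s - drOp f g s = z - ε • s := eq_sub_of_add_eq' hs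
  have hxu : prox f s + (s - prox f s) = s := by abel
  have est := mul_norm_sq_le_of_le_inner (x := prox f s) (u := s - prox f s)
    (y := prox g (reflProx f s)) (w := reflProx f s - prox g (reflProx f s)) (z := z)
    (p := x₀ - y₀ - z) (q := u₀ + w₀ - z) (C := C₁ + C₂) (δ := δ) (c := ‖prox f 0‖) hε
    (by linarith [hC₁ s, hC₂ (reflProx f s)])
    (by rw [hxu, ← hsz, sub_drOp]) (by rw [hxu, ← hsz, sub_drOp'])
    (by abel) (by abel) hp.le hq.le (by rw [hxu]; exact hf.norm_prox_le s)
    (by rw [hxu]; exact hf.norm_sub_prox_le s)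
  rw [hxu] at est
  dsimp only
  rw [hsz, dist_eq_norm, sub_sub_cancel, norm_smul, Real.norm_of_nonneg hε.le]
  suffices h : ε * ‖s‖ ≤ 3 * δ by linarith
  by_contra hlt
  have hlt := not_le.1 hlt
  have hsB : B < ‖s‖ := by
    rw [hεdef, div_mul_eq_mul_div, lt_div_iff₀ hB0] at hlt
    exact lt_of_mul_lt_mul_left hlt (by positivity)
  have h1 : |K| / δ * δ = |K| := div_mul_cancel₀ _ hδ0.ne'
  set a := ε * ‖s‖ with ha
  have h2 : a * ‖s‖ ≤ K + L * a + 2 * δ * ‖s‖ := by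
    rw [ha]
    linarith
  have h3 : (a - 2 * δ) * B ≤ (a - 2 * δ) * ‖s‖ :=
    mul_le_mul_of_nonneg_left hsB.le (by linarith)
  have h4 : |K| / δ * (a - 2 * δ) ≥ |K| / δ * δ :=
    mul_le_mul_of_nonneg_left (by linarith) (by positivity)
  have h5 : L * (a - 3 * δ) ≥ 0 := mul_nonneg hL0 (by linarith)
  have h6 : (a - 2 * δ) * B = |K| / δ * (a - 2 * δ) + 3 * L * (a - 2 * δ) + (a - 2 * δ) := by
    rw [hB]
    ring
  have h7 := le_abs_self K
  linarith

/-! ### Recession directions of the domain -/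

theorem mem_recCone_closure_dom {f : H → EReal} (hf : IsProperLscConvex f) {d : H} {σ : ℝ}
    (hd : ∀ u ∈ dom (conj f), inner ℝ d u ≤ σ) : d ∈ recCone (closure (dom f)) := by
  have : CompleteSpace H := FiniteDimensional.complete ℝ H
  have main : ∀ x ∈ dom f, d + x ∈ closure (dom f) := by
    intro x hx
    by_contra hnot
    obtain ⟨φ, β, h1, h2⟩ :=
      geometric_hahn_banach_closed_point hf.convex_dom.closure isClosed_closure hnot
    set a : H := (InnerProductSpace.toDual ℝ H).symm φ with ha
    have hφ : ∀ y, φ y = inner ℝ y a := by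
      intro y
      rw [real_inner_comm, ha, InnerProductSpace.toDual_symm_apply]
    have hbd : ∀ y ∈ dom f, inner ℝ y a ≤ β := fun y hy => by
      rw [← hφ]
      exact (h1 y (subset_closure hy)).le
    have hpos : 0 < inner ℝ d a := by
      have := h1 x (subset_closure hx)
      rw [map_add] at h2
      rw [← hφ]
      linarith
    obtain ⟨u, hu⟩ := hf.dom_conj_nonempty
    obtain ⟨n, hn⟩ := exists_nat_gt ((σ - inner ℝ d u) / inner ℝ d a)
    have h3 : u + (n : ℝ) • a ∈ dom (conj f) :=
      add_mem_dom_conj (β := n * β) (fun y hy => by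
        rw [inner_smul_right]
        exact mul_le_mul_of_nonneg_left (hbd y hy) n.cast_nonneg) hu
    have h4 := hd _ h3
    rw [inner_add_right, inner_smul_right] at h4
    rw [div_lt_iff₀ hpos] at hn
    linarith
  intro y hy
  exact closure_minimal main (isClosed_closure.preimage (continuous_const_add d)) hy

end Prox

theorem inner_le_zero_of_mem_recCone {C : Set H} (hC : C.Nonempty) {a k : H} {β : ℝ}
    (ha : ∀ x ∈ C, inner ℝ x a ≤ β) (hk : k ∈ recCone C) : inner ℝ k a ≤ 0 := by
  obtain ⟨x, hx⟩ := hC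
  have hn : ∀ n : ℕ, (n : ℝ) • k + x ∈ C := by
    intro n
    induction n with
    | zero => simpa using hx
    | succ n ih =>
      have := hk _ ih
      rwa [← add_assoc, show k + (n : ℝ) • k = ((n + 1 : ℕ) : ℝ) • k by push_cast; module] at this
  by_contra! hpos
  obtain ⟨n, h⟩ := exists_nat_gt ((β - inner ℝ x a) / inner ℝ k a)
  have h1 := ha _ (hn n)
  rw [inner_add_left, inner_smul_left] at h1
  simp only [conj_trivial] at h1
  rw [div_lt_iff₀ hpos] at h
  linarith

theorem inner_le_of_mem_closure {C : Set H} {a : H} {β : ℝ} (ha : ∀ x ∈ C, inner ℝ x a ≤ β) :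
    ∀ x ∈ closure C, inner ℝ x a ≤ β :=
  fun _ hx => closure_minimal (t := {x | inner ℝ x a ≤ β}) ha
    (isClosed_le (continuous_id.inner continuous_const) continuous_const) hx

/-! ### Projections -/

theorem norm_sq_le_inner_proj_zero [FiniteDimensional ℝ H] {C : Set H} (hne : C.Nonempty)
    (hcv : Convex ℝ C) {y : H} (hy : y ∈ closure C) :
    ‖proj (closure C) 0‖ ^ 2 ≤ inner ℝ (proj (closure C) 0) y := by
  have h := isArgmin_proj hne.closure isClosed_closure hcv.closure (0 : H)
  set p := proj (closure C) 0 with hp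
  have hle : ∀ z ∈ closure C, ‖0 - p‖ ≤ ‖0 - z‖ := by
    intro z hz
    by_cases hzp : z = p
    · rw [hzp]
    · have := (h.2 z hz hzp).le
      simpa using this
  have : Nonempty (closure C) := hne.closure.to_subtype
  have hinf : ‖0 - p‖ = ⨅ w : closure C, ‖0 - (w : H)‖ :=
    le_antisymm (le_ciInf fun w => hle w w.2)
      (ciInf_le ⟨0, by rintro _ ⟨w, rfl⟩; exact norm_nonneg _⟩ (⟨p, h.1⟩ : closure C))
  have h2 := (norm_eq_iInf_iff_real_inner_le_zero hcv.closure h.1).1 hinf y hy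
  rw [zero_sub, inner_neg_left, inner_sub_right, real_inner_self_eq_norm_sq] at h2
  linarith

/-- If `b` is orthogonal to `a ∈ C` and nonpositive on `C`, then `a` is the projection of `a + b`
onto `C`. -/
theorem proj_add_eq {C : Set H} {a b : H} (ha : a ∈ C) (hab : inner ℝ a b = 0)
    (hb : ∀ x ∈ C, inner ℝ x b ≤ 0) : proj C (a + b) = a := by
  refine IsArgmin.argmin_eq ⟨ha, fun y hy hne => ?_⟩
  have h1 : 0 < ‖y - a‖ := norm_pos_iff.2 (sub_ne_zero.2 hne)
  have h2 := hb y hy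
  refine lt_of_pow_lt_pow_left₀ 2 (norm_nonneg _) ?_
  dsimp only
  rw [← sub_sub y, norm_sub_sq_real (y - a) b, inner_sub_left, hab, sub_add_cancel_left, norm_neg]
  nlinarith

end DR

theorem mainTheorem5 {H : Type*} [NormedAddCommGroup H] [InnerProductSpace ℝ H]
    [FiniteDimensional ℝ H] (f g : H → EReal)
    (hf : DR.IsProperLscConvex f) (hg : DR.IsProperLscConvex g)
    (v vp vd : H) (hv : v = DR.minDispl f g) (hvp : vp = DR.primalVec f g)
    (hvd : vd = DR.dualVec f g) :
    DR.IsArgmin (fun y => ‖y‖) (closure (DR.displacements f g)) v ∧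
    v = vp + vd ∧
    inner ℝ vp vd = 0 ∧
    -vp = DR.proj (DR.polarCone (DR.recCone (closure (DR.dom f)))) (-v) ∧
    -vd = DR.proj (DR.recCone (closure (DR.dom f))) (-v) := by
  have hPne : (DR.dom f - DR.dom g).Nonempty := hf.dom_nonempty.sub hg.dom_nonempty
  have hPcv : Convex ℝ (DR.dom f - DR.dom g) := hf.convex_dom.sub hg.convex_dom
  have hDne : (DR.dom (DR.conj f) + DR.dom (DR.conj g)).Nonempty :=
    hf.dom_conj_nonempty.add hg.dom_conj_nonempty
  have hDcv : Convex ℝ (DR.dom (DR.conj f) + DR.dom (DR.conj g)) :=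
    (DR.convex_dom_conj f).add (DR.convex_dom_conj g)
  have hPmem : vp ∈ closure (DR.dom f - DR.dom g) := by
    rw [hvp]
    exact (DR.isArgmin_proj hPne.closure isClosed_closure hPcv.closure 0).1
  have hDmem : vd ∈ closure (DR.dom (DR.conj f) + DR.dom (DR.conj g)) := by
    rw [hvd]
    exact (DR.isArgmin_proj hDne.closure isClosed_closure hDcv.closure 0).1
  have hP : ∀ y ∈ closure (DR.dom f - DR.dom g), ‖vp‖ ^ 2 ≤ inner ℝ vp y := by
    rw [hvp]
    exact fun y hy => DR.norm_sq_le_inner_proj_zero hPne hPcv hy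
  have hD : ∀ y ∈ closure (DR.dom (DR.conj f) + DR.dom (DR.conj g)),
      ‖vd‖ ^ 2 ≤ inner ℝ vd y := by
    rw [hvd]
    exact fun y hy => DR.norm_sq_le_inner_proj_zero hDne hDcv hy
  obtain ⟨x₁, hx₁⟩ := hf.dom_nonempty
  obtain ⟨y₁, hy₁⟩ := hg.dom_nonempty
  obtain ⟨u₁, hu₁⟩ := hf.dom_conj_nonempty
  obtain ⟨w₁, hw₁⟩ := hg.dom_conj_nonempty
  have hP' : ∀ x ∈ DR.dom f, ∀ y ∈ DR.dom g, inner ℝ y vp ≤ inner ℝ x vp := by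
    intro x hx y hy
    have h := hP _ (subset_closure (Set.sub_mem_sub hx hy))
    rw [real_inner_comm, inner_sub_left] at h
    nlinarith [sq_nonneg ‖vp‖]
  have hD' : ∀ u ∈ DR.dom (DR.conj f), ∀ w ∈ DR.dom (DR.conj g),
      0 ≤ inner ℝ vd u + inner ℝ vd w := by
    intro u hu w hw
    have h := hD _ (subset_closure (Set.add_mem_add hu hw))
    rw [inner_add_right] at h
    nlinarith [sq_nonneg ‖vd‖]
  have hfbd : ∀ x ∈ DR.dom f, inner ℝ x (-vp) ≤ -inner ℝ y₁ vp := fun x hx => by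
    rw [inner_neg_right]
    linarith [hP' x hx y₁ hy₁]
  have hgbd : ∀ y ∈ DR.dom g, inner ℝ y vp ≤ inner ℝ x₁ vp := fun y hy => hP' x₁ hx₁ y hy
  have hrf : -vd ∈ DR.recCone (closure (DR.dom f)) :=
    DR.mem_recCone_closure_dom hf (σ := inner ℝ vd w₁) fun u hu => by
      rw [inner_neg_left]
      linarith [hD' u hu w₁ hw₁]
  have hrg : -vd ∈ DR.recCone (closure (DR.dom g)) :=
    DR.mem_recCone_closure_dom hg (σ := inner ℝ vd u₁) fun w hw => by
      rw [inner_neg_left]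
      linarith [hD' u₁ hu₁ w hw]
  have hpol : ∀ k ∈ DR.recCone (closure (DR.dom f)), inner ℝ k (-vp) ≤ 0 := fun k hk =>
    DR.inner_le_zero_of_mem_recCone hf.dom_nonempty.closure (DR.inner_le_of_mem_closure hfbd) hk
  have horth : inner ℝ vp vd = 0 := by
    have h1 := hpol _ hrf
    have h2 := DR.inner_le_zero_of_mem_recCone hg.dom_nonempty.closure
      (DR.inner_le_of_mem_closure hgbd) hrg
    rw [inner_neg_neg] at h1
    rw [inner_neg_left] at h2
    rw [real_inner_comm]
    linarith
  have hvP : vp + vd ∈ closure (DR.dom f - DR.dom g) := by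
    have main : ∀ z ∈ DR.dom f - DR.dom g, z + vd ∈ closure (DR.dom f - DR.dom g) := by
      rintro _ ⟨x, hx, y, hy, rfl⟩
      have h := hrg y (subset_closure hy)
      have e : x - y + vd = x - (-vd + y) := by abel
      dsimp only
      rw [e]
      exact map_mem_closure (f := fun y' => x - y') (by fun_prop) h
        fun y' hy' => Set.sub_mem_sub hx hy'
    exact closure_minimal main (isClosed_closure.preimage (continuous_add_const vd)) hPmem
  have hvD : vp + vd ∈ closure (DR.dom (DR.conj f) + DR.dom (DR.conj g)) := by
    refine map_mem_closure (f := fun z => vp + z) (by fun_prop) hDmem ?_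
    rintro _ ⟨u, hu, w, hw, rfl⟩
    have e : vp + (u + w) = u + (w + vp) := by abel
    dsimp only
    rw [e]
    exact Set.add_mem_add hu (DR.add_mem_dom_conj hgbd hw)
  have hmin : DR.IsArgmin (fun y => ‖y‖) (closure (DR.displacements f g)) (vp + vd) := by
    refine ⟨DR.mem_closure_displacements hf hg hvP hvD, fun d hd hne => ?_⟩
    have h1 := hP d (closure_mono (DR.displacements_subset_primal hf hg) hd)
    have h2 := hD d (closure_mono (DR.displacements_subset_dual hf hg) hd)
    have h3 : 0 < ‖d - (vp + vd)‖ := norm_pos_iff.2 (sub_ne_zero.2 hne)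
    have h4 := norm_sub_sq_real d (vp + vd)
    have h5 := norm_add_sq_real vp vd
    rw [inner_add_right, real_inner_comm vp d, real_inner_comm vd d] at h4
    rw [horth] at h5
    refine lt_of_pow_lt_pow_left₀ 2 (norm_nonneg _) ?_
    dsimp only
    nlinarith
  have hveq : v = vp + vd := by
    rw [hv]
    refine DR.IsArgmin.argmin_eq ?_
    simpa only [sub_zero] using hmin
  have horth' : inner ℝ (-vp) (-vd) = 0 := by rw [inner_neg_neg, horth]
  refine ⟨hveq ▸ hmin, hveq, horth, ?_, ?_⟩
  · have hpol' : -vp ∈ DR.polarCone (DR.recCone (closure (DR.dom f))) := hpol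
    rw [hveq, neg_add]
    refine (DR.proj_add_eq hpol' horth' fun x hx => ?_).symm
    rw [real_inner_comm]
    exact hx _ hrf
  · rw [hveq, neg_add_rev]
    refine (DR.proj_add_eq hrf ?_ hpol).symm
    rw [real_inner_comm, horth']
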